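/- Let $V$ be a finite set with $|V|=n$, let $G=(V,E)$ be a hidden connected unweighted graph, and let $\hat G=(V,\hat E)$ be a given connected unweighted graph with distance $\hat\delta$, maximum degree $\Delta$ and treewidth $\mathrm{tw}$. A shortest path oracle receives a pair $(u,v)\in V^2$ and returns (the vertex sequence of) some shortest path of $G$ between $u$ and $v$; its length is the distance $\delta(u,v)$ in $G$. A non-edge of $\hat G$ is a pair $\{a,b\}$ of distinct vertices with $\{a,b\}\notin\hat E$. For $(u,v)\in V^2$ let $S_{u,v}$ be the set of the non-edges $\{a,b\}$ of $\hat G$ with $\hat\delta(u,a)+\hat\delta(b,v)+1<\hat\delta(u,v)$ (for one of the two ways of naming the endpoints $a$ and $b$). Consider the following greedy algorithm. First query every $\{u,v\}\in\hat E$ (in any order), and return "no" if some $\{u,v\}\in\hat E$ has $\delta(u,v)\ne\hat\delta(u,v)$. Otherwise set $Y=\emptyset$, and while $\hat E\cup Y$ does not contain all pairs of distinct vertices, choose $(u,v)\in V^2$ that maximizes $|S_{u,v}\setminus Y|$ (ties broken by any fixed rule), query $(u,v)$, and if $\delta(u,v)=\hat\delta(u,v)$ replace $Y$ by $Y\cup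 S_{u,v}$, else return "no". When the loop ends, return "yes". Then, for every connected $\hat G$ and $G$ on $V$, and whichever shortest paths the oracle returns, the algorithm halts and returns "yes" if and only if $G=\hat G$, and the number of its queries is 1. at most $n^{1+C\sqrt{(\log\log n+\log\Delta)/\log n}}$ whenever $n\ge 3$, where $C>0$ is an absolute constant; in particular it is at most $n^{1+o(1)}$, uniformly over all such instances, when $\Delta\le\Delta(n)$ with $\Delta(n)=n^{o(1)}$; 2. at most $C\,\Delta(\Delta+\mathrm{tw}\log n)\,n\log^2 n$, where $C>0$ is an absolute constant; in particular it is at most $O(n\,\mathrm{polylog}\,n)$, uniformly over all such instances, when $\Delta\le\Delta(n)$ and $\mathrm{tw}\le\tau(n)$ with $\Delta(n)$ and $\tau(n)$ both $O(\mathrm{polylog}\,n)$. -/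

import Mathlib

universe u v w

/-! ### Query algorithms -/

/-- What a query algorithm does in a given state: halt with an answer (`true` for "yes"), or query
the pair `(u, v)` and move to the state `next a`, where `a` is the answer of the oracle. -/
inductive QueryAction (V : Type u) (A : Type v) (S : Type u) : Type (max u v)
  | output (b : Bool) : QueryAction V A S
  | query (u v : V) (next : A → S) : QueryAction V A S

/-- A deterministic adaptive algorithm that outputs "yes" or "no" and queries an oracle which
receives pairs of elements of `V` and returns elements of `A`. -/
structure QueryAlgorithm (V : Type u) (A : Type v) where
  State : Type u
  init : State
  act : State → QueryAction V A State

/-- `M.HaltsFrom O s b q`: started in state `s` with the oracle `O`, the algorithm `M` halts with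
output `b` after exactly `q` queries. -/
inductive QueryAlgorithm.HaltsFrom {V : Type u} {A : Type v} (M : QueryAlgorithm V A) (O : V → V → A) :
    M.State → Bool → ℕ → Prop
  | output {s : M.State} {b : Bool} (h : M.act s = QueryAction.output b) :
      QueryAlgorithm.HaltsFrom M O s b 0
  | query {s : M.State} {u v : V} {next : A → M.State} {b : Bool} {q : ℕ}
      (h : M.act s = QueryAction.query u v next)
      (hnext : QueryAlgorithm.HaltsFrom M O (next (O u v)) b q) :
      QueryAlgorithm.HaltsFrom M O s b (q + 1)

/-- With the oracle `O`, the algorithm halts with output `b` after exactly `q` queries. -/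
def QueryAlgorithm.Halts {V : Type u} {A : Type v} (M : QueryAlgorithm V A) (O : V → V → A)
    (b : Bool) (q : ℕ) : Prop :=
  M.HaltsFrom O M.init b q

/-- Run `M` with an oracle whose answers lie in `A'`: each query of `M` is answered by making the
same query to that oracle and applying `f` to its answer. -/
def QueryAlgorithm.simulate {V : Type u} {A : Type v} {A' : Type w} (M : QueryAlgorithm V A) (f : A' → A) :
    QueryAlgorithm V A' where
  State := M.State
  init := M.init
  act s :=
    match M.act s with
    | QueryAction.output b => QueryAction.output b
    | QueryAction.query u v next => QueryAction.query u v (fun a => next (f a))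

/-! ### The shortest path oracle and the verification problem -/

/-- `O` is a shortest path oracle for `G`: on the query `(u, v)` it returns a shortest path of `G`
from `u` to `v`, as the list of its vertices. -/
def IsShortestPathOracle {V : Type u} (G : SimpleGraph V) (O : V → V → List V) : Prop :=
  ∀ u v : V, ∃ p : G.Walk u v, p.length = G.dist u v ∧ O u v = p.support

/-- The number of edges of a path that is given as the list of its vertices. -/
def pathLength {V : Type u} (p : List V) : ℕ := p.length - 1

/-- With access to a shortest path oracle for the hidden connected graph `G`, the algorithm `M`
always halts, makes at most `B` queries, and answers "yes" exactly when `G` is equal to `H`;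
whatever `G` is and whichever shortest paths the oracle returns. -/
def VerifiesWithShortestPaths {V : Type u} (M : QueryAlgorithm V (List V)) (H : SimpleGraph V)
    (B : ℝ) : Prop :=
  ∀ G : SimpleGraph V, G.Connected → ∀ O : V → V → List V, IsShortestPathOracle G O →
    ∃ (b : Bool) (q : ℕ), M.Halts O b q ∧ (b = true ↔ G = H) ∧ (q : ℝ) ≤ B

/-! ### The greedy verification algorithm -/

/-- The set `S_{u,v}` of the non-edges `{a, b}` of `H` with `δ(u,a) + δ(b,v) + 1 < δ(u,v)`, where
`δ` is the distance in `H`. -/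
def confirmedNonEdges {V : Type u} (H : SimpleGraph V) (u v : V) : Set (Sym2 V) :=
  {e | ∃ a b : V, e = s(a, b) ∧ a ≠ b ∧ ¬ H.Adj a b ∧
    H.dist u a + H.dist b v + 1 < H.dist u v}

/-- The choices that the pseudocode of the greedy algorithm leaves open: an order in which the
edges of `H` are listed (each exactly once, with one of its two orientations), and, for each set `Y`
of confirmed non-edges, a pair `(u, v)` that maximizes `|S_{u,v} \ Y|`. -/
structure GreedyChoices {V : Type u} (H : SimpleGraph V) where
  edges : List (V × V)
  edges_nodup : (edges.map fun p => s(p.1, p.2)).Nodup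
  mem_edges : ∀ e : Sym2 V, e ∈ edges.map (fun p => s(p.1, p.2)) ↔ e ∈ H.edgeSet
  choose : Set (Sym2 V) → V × V
  choose_max : ∀ (Y : Set (Sym2 V)) (u v : V),
    (confirmedNonEdges H u v \ Y).ncard ≤
      (confirmedNonEdges H (choose Y).1 (choose Y).2 \ Y).ncard

/-- The choices can always be made. -/
theorem GreedyChoices.nonempty {V : Type u} [Finite V] [Nonempty V] (H : SimpleGraph V) :
    Nonempty (GreedyChoices H) := by
  classical
  have hmax : ∀ Y : Set (Sym2 V), ∃ p : V × V, ∀ u v : V,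
      (confirmedNonEdges H u v \ Y).ncard ≤ (confirmedNonEdges H p.1 p.2 \ Y).ncard := by
    intro Y
    obtain ⟨p, hp⟩ := Finite.exists_max
      (fun p : V × V => (confirmedNonEdges H p.1 p.2 \ Y).ncard)
    exact ⟨p, fun u v => hp (u, v)⟩
  choose c hc using hmax
  have hout : (fun p : V × V => s(p.1, p.2)) ∘ (Quot.out : Sym2 V → V × V) = id := by
    funext e
    exact Quot.out_eq e
  refine ⟨⟨(Set.toFinite H.edgeSet).toFinset.toList.map Quot.out, ?_, ?_, c, hc⟩⟩
  · rw [List.map_map, hout, List.map_id]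
    exact Finset.nodup_toList _
  · intro e
    rw [List.map_map, hout, List.map_id]
    simp

/-- The states of the greedy algorithm: in the first loop, with the edges that remain to be queried
and a flag telling whether all answers so far were as in `H`; in the second loop, with the current
set `Y`; and the state in which it is about to return "no". -/
inductive GreedyState (V : Type u) : Type u
  | checkEdges (todo : List (V × V)) (ok : Bool) : GreedyState V
  | loop (Y : Set (Sym2 V)) : GreedyState V
  | reject : GreedyState V

open Classical in
/-- The loop of the greedy algorithm with the current set `Y`: return "yes" if every pair of
distinct vertices is an edge of `H` or belongs to `Y`; otherwise query the chosen pair. -/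
noncomputable def greedyLoop {V : Type u} {H : SimpleGraph V} (c : GreedyChoices H)
    (Y : Set (Sym2 V)) : QueryAction V ℕ (GreedyState V) :=
  if ∀ a b : V, a ≠ b → s(a, b) ∈ H.edgeSet ∪ Y then
    QueryAction.output true
  else
    QueryAction.query (c.choose Y).1 (c.choose Y).2 fun d =>
      if d = H.dist (c.choose Y).1 (c.choose Y).2 then
        GreedyState.loop (Y ∪ confirmedNonEdges H (c.choose Y).1 (c.choose Y).2)
      else
        GreedyState.reject

/-- The greedy verification algorithm for the given graph `H`, in terms of distance queries. -/
noncomputable def greedyVerify {V : Type u} {H : SimpleGraph V} (c : GreedyChoices H) :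
    QueryAlgorithm V ℕ where
  State := GreedyState V
  init := GreedyState.checkEdges c.edges true
  act
    | GreedyState.checkEdges (p :: todo) ok =>
        QueryAction.query p.1 p.2 fun d =>
          GreedyState.checkEdges todo (ok && decide (d = H.dist p.1 p.2))
    | GreedyState.checkEdges [] false => QueryAction.output false
    | GreedyState.checkEdges [] true => greedyLoop c ∅
    | GreedyState.loop Y => greedyLoop c Y
    | GreedyState.reject => QueryAction.output false

/-- With a shortest path oracle in place of the distance oracle, the greedy algorithm solves the
verification problem for the given graph `H` with at most `B` queries, however its edges are
ordered and ties are broken. -/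
def GreedyVerifiesWithin {V : Type u} (H : SimpleGraph V) (B : ℝ) : Prop :=
  ∀ c : GreedyChoices H, VerifiesWithShortestPaths ((greedyVerify c).simulate pathLength) H B

/-! ### Treewidth -/

/-- A tree decomposition of `G`: a finite tree with a bag of vertices at each node. -/
structure TreeDecomposition {V : Type u} (G : SimpleGraph V) where
  size : ℕ
  tree : SimpleGraph (Fin size)
  isTree : tree.IsTree
  bag : Fin size → Finset V
  connected_nodes : ∀ v : V, (tree.induce {t | v ∈ bag t}).Connected
  exists_bag : ∀ u v : V, G.Adj u v → ∃ t, u ∈ bag t ∧ v ∈ bag t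

/-- The size of the largest bag minus 1. -/
def TreeDecomposition.width {V : Type u} {G : SimpleGraph V} (D : TreeDecomposition G) : ℕ :=
  (Finset.univ.sup fun t => (D.bag t).card) - 1

/-- The minimum width over all tree decompositions. -/
noncomputable def treewidth {V : Type u} (G : SimpleGraph V) : ℕ :=
  sInf (Set.range fun D : TreeDecomposition G => D.width)

/-- Every finite graph has a tree decomposition, so that the minimum above is attained. -/
theorem TreeDecomposition.nonempty {V : Type u} [Fintype V] (G : SimpleGraph V) :
    Nonempty (TreeDecomposition G) := by
  refine ⟨⟨1, ⊥, SimpleGraph.IsTree.of_subsingleton, fun _ => Finset.univ, fun v => ?_,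
    fun u v _ => ⟨0, by simp⟩⟩⟩
  have : Nonempty ↑{t : Fin 1 | v ∈ (Finset.univ : Finset V)} := ⟨⟨0, by simp⟩⟩
  exact ⟨SimpleGraph.Preconnected.of_subsingleton⟩

/-! ### Certificates for non-edges -/

section Certificates

variable {V : Type u} {G H : SimpleGraph V}

/-! The second loop is the greedy algorithm for set cover: the ground set consists of the non-edges
of `H`, and the available sets are the $S_{u,v}$. If a set `Q` of queries covers all non-edges, each
greedy query confirms at least a $1/|Q|$ fraction of what is left, so the loop makes at most
$|Q|(1+2\log n)$ queries (`greedyVerifiesWithin_of_confirmsOn`). Correctness is the triangle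
inequality (`not_adj_of_mem_confirmedNonEdges`). It remains to exhibit small covers, which the
algorithm never sees; both are recursive.

Treewidth (`TreeDecomposition.exists_confirmsOn`): some bag `B` splits `U` into parts of at most
half its size. Queries from the closed neighborhood of `B` to `U` confirm every non-edge between
different parts, and the parts are disjoint, so each of the $O(\log n)$ levels costs
$O(\mathrm{tw}\,\Delta\, n)$.

Degree (`exists_confirmsOn_of_pow`): Thorup–Zwick style sampling gives about $s\log n$ centers `A`
whose clusters have size at most $2|U|/(s+1)$. Queries from the vertices within distance 2 of `A` to
`U` confirm every non-edge that is not inside the cluster of one of these vertices. The recursion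
goes into the clusters. They overlap, so each level multiplies the cost by $O(\Delta^2\log n)$;
balancing this against $s\approx n^{1/j}$ for depth $j$ gives the exponent with the square root. -/

theorem mem_confirmedNonEdges_of_dist {u v x : V} (hne : u ≠ v) (hadj : ¬ H.Adj u v)
    (h : H.dist x u + 1 < H.dist x v) : s(u, v) ∈ confirmedNonEdges H x v :=
  ⟨u, v, rfl, hne, hadj, by simpa using h⟩

theorem mem_confirmedNonEdges_self (hH : H.Connected) {u v : V} (hne : u ≠ v)
    (hadj : ¬ H.Adj u v) : s(u, v) ∈ confirmedNonEdges H u v :=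
  mem_confirmedNonEdges_of_dist hne hadj
    (by simpa using hH.one_lt_dist_of_ne_of_not_adj hne hadj)

/-- An edge $ab$ of `G` would close a walk $u\to a\to b\to v$ in `G` shorter than $\delta(u,v)$,
because distances in `G` are at most those in `H`. -/
theorem not_adj_of_mem_confirmedNonEdges (hG : G.Connected) (hH : H.Connected) (hHG : H ≤ G)
    {u v a b : V} (hd : G.dist u v = H.dist u v) (h : s(a, b) ∈ confirmedNonEdges H u v) :
    ¬ G.Adj a b := by
  obtain ⟨a', b', he, -, -, hlt⟩ := h
  intro hab
  have hab' : G.Adj a' b' := by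
    rw [← SimpleGraph.mem_edgeSet, he, SimpleGraph.mem_edgeSet] at hab
    exact hab
  have h1 : G.dist u v ≤ G.dist u a' + G.dist a' v := hG.dist_triangle
  have h2 : G.dist a' v ≤ G.dist a' b' + G.dist b' v := hG.dist_triangle
  have h3 : G.dist a' b' = 1 := SimpleGraph.dist_eq_one_iff_adj.2 hab'
  have h4 : G.dist u a' ≤ H.dist u a' := (hH.preconnected u a').dist_anti hHG
  have h5 : G.dist b' v ≤ H.dist b' v := (hH.preconnected b' v).dist_anti hHG
  omega

/-- The set of all non-edges of `H`. -/
def nonEdges (H : SimpleGraph V) : Set (Sym2 V) :=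
  {e | ∃ a b : V, e = s(a, b) ∧ a ≠ b ∧ ¬ H.Adj a b}

theorem confirmedNonEdges_subset (u v : V) : confirmedNonEdges H u v ⊆ nonEdges H := by
  rintro e ⟨a, b, he, hne, hadj, -⟩
  exact ⟨a, b, he, hne, hadj⟩

theorem ncard_nonEdges_le [Fintype V] (H : SimpleGraph V) :
    (nonEdges H).ncard ≤ Fintype.card V ^ 2 := by
  classical
  have hsub : nonEdges H ⊆ (fun p : V × V => s(p.1, p.2)) '' Set.univ := by
    rintro e ⟨a, b, he, -, -⟩
    exact ⟨(a, b), trivial, he.symm⟩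
  refine (Set.ncard_le_ncard hsub (Set.toFinite _)).trans ((Set.ncard_image_le).trans ?_)
  rw [Set.ncard_univ, Nat.card_eq_fintype_card, Fintype.card_prod, sq]

/-- The queries in `Q` confirm all non-edges of `H` inside of `U`. -/
def ConfirmsOn (H : SimpleGraph V) (U : Finset V) (Q : Finset (V × V)) : Prop :=
  ∀ u ∈ U, ∀ v ∈ U, u ≠ v → ¬ H.Adj u v → ∃ p ∈ Q, s(u, v) ∈ confirmedNonEdges H p.1 p.2

/-- The sets of `Q` cover what remains, and the greedy choice gains at least as much as any one of
them. -/
theorem ncard_diff_le_of_confirmsOn [Fintype V] {Q : Finset (V × V)}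
    (hQ : ConfirmsOn H Finset.univ Q) (c : GreedyChoices H) (Y : Set (Sym2 V)) :
    (nonEdges H \ Y).ncard ≤
      Q.card * (confirmedNonEdges H (c.choose Y).1 (c.choose Y).2 \ Y).ncard := by
  classical
  have hsub : nonEdges H \ Y ⊆ ⋃ p ∈ Q, (confirmedNonEdges H p.1 p.2 \ Y) := by
    rintro e ⟨⟨a, b, rfl, hne, hadj⟩, hY⟩
    obtain ⟨p, hp, hmem⟩ := hQ a (Finset.mem_univ a) b (Finset.mem_univ b) hne hadj
    exact Set.mem_biUnion hp ⟨hmem, hY⟩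
  refine (Set.ncard_le_ncard hsub (Set.toFinite _)).trans ?_
  refine (Finset.set_ncard_biUnion_le Q _).trans ?_
  rw [← smul_eq_mul]
  exact Finset.sum_le_card_nsmul _ _ _ fun p _ => c.choose_max Y p.1 p.2

end Certificates

/-! ### The number of queries of the greedy algorithm -/

/-- One step of the set cover analysis: $1\le k(1-r'/r)\le k\log(r/r')$, so the drop of the
potential $k(1+\log r)$ pays for a query. -/
theorem one_add_mul_one_add_log_le {k r r' : ℕ} (hr' : 0 < r') (h : r ≤ k * (r - r'))
    (hlt : r' < r) : (1 : ℝ) + k * (1 + Real.log r') ≤ k * (1 + Real.log r) := by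
  have hr0 : (0 : ℝ) < r := by exact_mod_cast hr'.trans hlt
  have hr'0 : (0 : ℝ) < r' := by exact_mod_cast hr'
  have hk : (r : ℝ) ≤ k * ((r : ℝ) - r') := by
    have : ((r - r' : ℕ) : ℝ) = (r : ℝ) - r' := Nat.cast_sub hlt.le
    rw [← this]
    exact_mod_cast h
  have hlog : Real.log r' - Real.log r ≤ r' / r - 1 := by
    rw [← Real.log_div hr'0.ne' hr0.ne']
    exact Real.log_le_sub_one_of_pos (div_pos hr'0 hr0)
  have h1 : (1 : ℝ) ≤ k * (1 - r' / r) := by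
    have : (k : ℝ) * (1 - r' / r) = k * ((r : ℝ) - r') / r := by field_simp
    rw [this, le_div_iff₀ hr0]
    linarith
  have h2 : (k : ℝ) * (Real.log r' - Real.log r) ≤ k * (r' / r - 1) :=
    mul_le_mul_of_nonneg_left hlog (Nat.cast_nonneg k)
  linarith

section Greedy

variable {V : Type u} {G H : SimpleGraph V} {O : V → V → List V}

theorem pathLength_oracle (hO : IsShortestPathOracle G O) (u v : V) :
    pathLength (O u v) = G.dist u v := by
  obtain ⟨p, hp, h⟩ := hO u v
  rw [h, pathLength, SimpleGraph.Walk.length_support, hp]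
  rfl

/-- Strong induction on the number `r` of unconfirmed non-edges. The state is left general because
both `loop Y` and `checkEdges [] true` act as the loop. -/
theorem greedyVerify_halts_of_loop [Fintype V] (hG : G.Connected) (hH : H.Connected) (hHG : H ≤ G)
    (hO : IsShortestPathOracle G O) (c : GreedyChoices H) {Q : Finset (V × V)}
    (hQ : ConfirmsOn H Finset.univ Q) (r : ℕ) :
    ∀ (Y : Set (Sym2 V)) (s : GreedyState V), (greedyVerify c).act s = greedyLoop c Y →
      (∀ a b, s(a, b) ∈ Y → ¬ G.Adj a b) → (nonEdges H \ Y).ncard = r →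
      ∃ (b : Bool) (q : ℕ), ((greedyVerify c).simulate pathLength).HaltsFrom O s b q ∧
        (b = true ↔ G = H) ∧ (r = 0 → q = 0) ∧ (q : ℝ) ≤ Q.card * (1 + Real.log r) := by
  classical
  induction r using Nat.strong_induction_on with
  | _ r ih =>
  intro Y s hs hY hr
  have hlog : 0 ≤ Real.log r := Real.log_natCast_nonneg r
  by_cases hall : ∀ a b : V, a ≠ b → s(a, b) ∈ H.edgeSet ∪ Y
  · refine ⟨true, 0, .output ?_, ?_, fun _ => rfl, by push_cast; positivity⟩
    · simp only [QueryAlgorithm.simulate, hs, greedyLoop, if_pos hall]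
    · refine ⟨fun _ => le_antisymm (fun a b hab => ?_) hHG, fun _ => rfl⟩
      rcases hall a b hab.ne with h | h
      · exact h
      · exact absurd hab (hY a b h)
  · set p := c.choose Y with hp
    have hact : ((greedyVerify c).simulate pathLength).act s =
        QueryAction.query p.1 p.2 fun a : List V =>
          if pathLength a = H.dist p.1 p.2 then
            GreedyState.loop (Y ∪ confirmedNonEdges H p.1 p.2) else GreedyState.reject := by
      simp only [QueryAlgorithm.simulate, hs, greedyLoop, if_neg hall]
      rfl
    have hrpos : 0 < r := by
      rw [← hr, Set.ncard_pos (Set.toFinite _)]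
      push Not at hall
      obtain ⟨a, b, hne, hab⟩ := hall
      rw [Set.mem_union, not_or] at hab
      exact ⟨s(a, b), ⟨a, b, rfl, hne, hab.1⟩, hab.2⟩
    have hQpos : 0 < Q.card := by
      have := ncard_diff_le_of_confirmsOn hQ c Y
      rw [hr] at this
      exact Nat.pos_of_mul_pos_right (hrpos.trans_le this)
    have hQone : (1 : ℝ) ≤ Q.card := by exact_mod_cast hQpos
    by_cases hd : G.dist p.1 p.2 = H.dist p.1 p.2
    · have hr' := ncard_diff_le_of_confirmsOn hQ c Y
      rw [hr, ← hp] at hr'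
      have hsplit : (nonEdges H \ (Y ∪ confirmedNonEdges H p.1 p.2)).ncard +
          (confirmedNonEdges H p.1 p.2 \ Y).ncard = r := by
        rw [← hr, ← Set.ncard_union_eq _ (Set.toFinite _) (Set.toFinite _)]
        · congr 1
          ext e
          have := @confirmedNonEdges_subset V H p.1 p.2 e
          simp only [Set.mem_union, Set.mem_sdiff]
          tauto
        · rw [Set.disjoint_left]
          simp only [Set.mem_union, Set.mem_sdiff]
          tauto
      have hlt : (nonEdges H \ (Y ∪ confirmedNonEdges H p.1 p.2)).ncard < r := by
        have : 0 < (confirmedNonEdges H p.1 p.2 \ Y).ncard :=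
          Nat.pos_of_mul_pos_left (hrpos.trans_le hr')
        omega
      obtain ⟨b, q, hhalt, hb, hq0, hq⟩ := ih _ hlt (Y ∪ confirmedNonEdges H p.1 p.2)
        (GreedyState.loop (Y ∪ confirmedNonEdges H p.1 p.2)) rfl
        (fun a b hab => hab.elim (hY a b) (not_adj_of_mem_confirmedNonEdges hG hH hHG hd)) rfl
      refine ⟨b, q + 1, .query hact ?_, hb, fun h => absurd h hrpos.ne', ?_⟩
      · rw [if_pos ((pathLength_oracle hO _ _).trans hd)]
        exact hhalt
      · set r' := (nonEdges H \ (Y ∪ confirmedNonEdges H p.1 p.2)).ncard with hr'def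
        -- Since `Real.log 0 = 0`, the potential at `r' = 0` is still `Q.card` and would not pay for
        -- the last query; the clause `r = 0 → q = 0` does.
        rcases Nat.eq_zero_or_pos r' with h0 | h0
        · rw [hq0 h0]
          push_cast
          nlinarith
        · have := one_add_mul_one_add_log_le (k := Q.card) h0
            (by rwa [show r - r' = (confirmedNonEdges H p.1 p.2 \ Y).ncard by omega]) hlt
          push_cast
          linarith
    · refine ⟨false, 1, .query hact ?_, ?_, fun h => absurd h hrpos.ne', ?_⟩
      · rw [if_neg (fun h => hd ((pathLength_oracle hO _ _).symm.trans h))]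
        exact .output rfl
      · simp only [Bool.false_eq_true, false_iff]
        rintro rfl
        exact hd rfl
      · push_cast
        nlinarith

/-- The first loop always runs to its end; a wrong answer only changes the flag, so its cost is the
number of edges in every case. -/
theorem halts_of_halts_checkEdges_nil (hO : IsShortestPathOracle G O) (c : GreedyChoices H)
    {b : Bool} {q : ℕ} (todo : List (V × V)) :
    ∀ ok : Bool, ((greedyVerify c).simulate pathLength).HaltsFrom O
      (GreedyState.checkEdges []
        (ok && todo.all fun p => decide (G.dist p.1 p.2 = H.dist p.1 p.2))) b q →
    ((greedyVerify c).simulate pathLength).HaltsFrom O (GreedyState.checkEdges todo ok) b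
      (q + todo.length) := by
  induction todo with
  | nil => intro ok h; simpa using h
  | cons p todo ih =>
    intro ok h
    refine .query (u := p.1) (v := p.2)
      (next := fun a => GreedyState.checkEdges todo
        (ok && decide (pathLength a = H.dist p.1 p.2))) rfl (ih _ ?_)
    rw [pathLength_oracle hO]
    simpa [Bool.and_assoc] using h

theorem length_edges_le [Fintype V] [DecidableRel H.Adj] (c : GreedyChoices H) :
    c.edges.length ≤ Fintype.card V * H.maxDegree := by
  classical
  have h1 : c.edges.length = H.edgeFinset.card := by
    rw [← List.length_map (f := fun p : V × V => s(p.1, p.2)),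
      ← List.toFinset_card_of_nodup c.edges_nodup]
    congr 1
    ext e
    rw [List.mem_toFinset, c.mem_edges, SimpleGraph.mem_edgeFinset]
  have h2 := H.sum_degrees_eq_twice_card_edges
  have h3 : ∑ v, H.degree v ≤ Fintype.card V * H.maxDegree := by
    rw [← smul_eq_mul, ← Finset.card_univ]
    exact Finset.sum_le_card_nsmul _ _ _ fun v _ => H.degree_le_maxDegree v
  omega

theorem greedyVerifiesWithin_of_confirmsOn [Fintype V] [DecidableRel H.Adj] (hH : H.Connected)
    {Q : Finset (V × V)} (hQ : ConfirmsOn H Finset.univ Q) :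
    GreedyVerifiesWithin H (Fintype.card V * H.maxDegree +
      Q.card * (1 + 2 * Real.log (Fintype.card V))) := by
  intro c G hG O hO
  have hlen : (c.edges.length : ℝ) ≤ Fintype.card V * H.maxDegree := by
    exact_mod_cast length_edges_le c
  have hn : 0 ≤ Real.log (Fintype.card V) := Real.log_natCast_nonneg _
  by_cases hall : ∀ p ∈ c.edges, G.dist p.1 p.2 = H.dist p.1 p.2
  · have hHG : H ≤ G := by
      intro a b hab
      obtain ⟨p, hp, hpe⟩ := List.mem_map.1 ((c.mem_edges s(a, b)).2 hab)
      have hpH : H.Adj p.1 p.2 := by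
        rw [← SimpleGraph.mem_edgeSet, hpe]
        exact hab
      have hpG : G.Adj p.1 p.2 := by
        rw [← SimpleGraph.dist_eq_one_iff_adj, hall p hp, SimpleGraph.dist_eq_one_iff_adj]
        exact hpH
      rw [← SimpleGraph.mem_edgeSet, ← hpe]
      exact hpG
    obtain ⟨b, q, hhalt, hb, -, hq⟩ := greedyVerify_halts_of_loop hG hH hHG hO c hQ _ ∅
      (GreedyState.checkEdges [] true) rfl (by simp) rfl
    refine ⟨b, q + c.edges.length, halts_of_halts_checkEdges_nil hO c c.edges true ?_, hb, ?_⟩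
    · rwa [List.all_eq_true.2 (fun p hp => decide_eq_true (hall p hp))]
    · have hlog : Real.log ((nonEdges H \ ∅).ncard : ℕ) ≤ 2 * Real.log (Fintype.card V) := by
        rw [Set.sdiff_empty]
        rcases Nat.eq_zero_or_pos (nonEdges H).ncard with h0 | h0
        · rw [h0, Nat.cast_zero, Real.log_zero]
          positivity
        · have h2 : ((2 : ℕ) : ℝ) * Real.log (Fintype.card V) =
              Real.log ((Fintype.card V : ℝ) ^ 2) := (Real.log_pow _ _).symm
          rw [Nat.cast_ofNat] at h2
          rw [h2]
          refine Real.log_le_log (by exact_mod_cast h0) ?_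
          exact_mod_cast ncard_nonEdges_le H
      have := mul_le_mul_of_nonneg_left hlog (Nat.cast_nonneg (α := ℝ) Q.card)
      push_cast
      linarith
  · refine ⟨false, 0 + c.edges.length, halts_of_halts_checkEdges_nil hO c c.edges true ?_, ?_, ?_⟩
    · have : (c.edges.all fun p => decide (G.dist p.1 p.2 = H.dist p.1 p.2)) = false := by
        rw [Bool.eq_false_iff]
        intro h
        exact hall fun p hp => of_decide_eq_true (List.all_eq_true.1 h p hp)
      rw [this]
      exact .output rfl
    · simp only [Bool.false_eq_true, false_iff]
      rintro rfl
      exact hall fun _ _ => rfl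
    · have : (0 : ℝ) ≤ Q.card * (1 + 2 * Real.log (Fintype.card V)) := by positivity
      push_cast
      linarith

theorem GreedyVerifiesWithin.mono {B B' : ℝ} (h : GreedyVerifiesWithin H B) (hB : B ≤ B') :
    GreedyVerifiesWithin H B' := by
  intro c G hG O hO
  obtain ⟨b, q, h1, h2, h3⟩ := h c G hG O hO
  exact ⟨b, q, h1, h2, h3.trans hB⟩

end Greedy

/-! ### Closed neighborhoods and separators -/

section Neighborhoods

variable {V : Type u} [Fintype V] [DecidableEq V] (H : SimpleGraph V) [DecidableRel H.Adj]

/-- The vertices of `B` and their neighbors. -/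
def closedNhd (B : Finset V) : Finset V :=
  B.biUnion fun b => insert b (H.neighborFinset b)

variable {H}

theorem subset_closedNhd (B : Finset V) : B ⊆ closedNhd H B := fun b hb =>
  Finset.mem_biUnion.2 ⟨b, hb, Finset.mem_insert_self _ _⟩

theorem mem_closedNhd_of_adj {B : Finset V} {b x : V} (hb : b ∈ B) (h : H.Adj b x) :
    x ∈ closedNhd H B :=
  Finset.mem_biUnion.2 ⟨b, hb, Finset.mem_insert_of_mem ((H.mem_neighborFinset b x).2 h)⟩

theorem card_closedNhd_le (B : Finset V) :
    (closedNhd H B).card ≤ B.card * (H.maxDegree + 1) := by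
  refine Finset.card_biUnion_le_card_mul _ _ _ fun b _ => ?_
  refine (Finset.card_insert_le _ _).trans ?_
  rw [SimpleGraph.card_neighborFinset_eq_degree]
  exact Nat.succ_le_succ (H.degree_le_maxDegree b)

end Neighborhoods

section Separators

variable {V : Type u}

/-- The graph `H` without the edges at vertices of `B`. -/
def isolate (H : SimpleGraph V) (B : Finset V) : SimpleGraph V where
  Adj a b := H.Adj a b ∧ a ∉ B ∧ b ∉ B
  symm := ⟨fun _ _ h => ⟨h.1.symm, h.2.2, h.2.1⟩⟩
  loopless := ⟨fun _ h => h.1.ne rfl⟩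

variable {H : SimpleGraph V} {B : Finset V}

theorem isolate_reachable_or_exists {x y : V} (p : H.Walk x y) :
    (isolate H B).Reachable x y ∨ ∃ z ∈ B, z ∈ p.support := by
  induction p with
  | nil => exact Or.inl .rfl
  | @cons x x' y h p ih =>
    rcases ih with ih | ⟨z, hz, hzp⟩
    · by_cases hx : x ∈ B
      · exact Or.inr ⟨x, hx, by simp⟩
      by_cases hx' : x' ∈ B
      · exact Or.inr ⟨x', hx', by simp⟩
      have hadj : (isolate H B).Adj x x' := ⟨h, hx, hx'⟩
      exact Or.inl (hadj.reachable.trans ih)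
    · exact Or.inr ⟨z, hz, by simp [hzp]⟩

theorem eq_of_isolate_reachable_of_mem {x y : V} (h : (isolate H B).Reachable x y) (hx : x ∈ B) :
    x = y := by
  obtain ⟨p⟩ := h
  cases p with
  | nil => rfl
  | cons h _ => exact absurd hx h.2.1

/-- If `b` is a vertex of the separator `B` closest to `u`, and not farther from `u` than any
vertex of `B` is from `v`, then `b` has a neighbor that is closer to `u` than to `v` by at
least 2. -/
theorem exists_adj_dist_add_one_lt (hH : H.Connected) {b u v : V} (hb : b ∈ B)
    (hu : u ∉ B) (hbu : ∀ z ∈ B, H.dist b u ≤ H.dist z u) (hbv : ∀ z ∈ B, H.dist b u ≤ H.dist z v)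
    (huv : ¬ (isolate H B).Reachable u v) :
    ∃ x, H.Adj b x ∧ H.dist x u + 1 < H.dist x v := by
  obtain ⟨p, hp⟩ := hH.exists_walk_length_eq_dist b u
  cases p with
  | nil => exact absurd hb hu
  | @cons _ x _ h p =>
    rw [SimpleGraph.Walk.length_cons] at hp
    have hxu : H.dist x u ≤ p.length := SimpleGraph.dist_le p
    -- The rest of the path is shorter than $d(b,u)$, so a vertex of `B` on it would be closer to
    -- `u` than `b`.
    have havoid : ∀ z ∈ p.support, z ∉ B := by
      intro z hz hzB
      classical
      have h1 := SimpleGraph.dist_le (p.dropUntil z hz)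
      have h2 := p.length_dropUntil_le_length hz
      have h3 := hbu z hzB
      omega
    have hreach : (isolate H B).Reachable x u := by
      rcases isolate_reachable_or_exists (B := B) p with h' | ⟨z, hz, hzp⟩
      · exact h'
      · exact absurd hz (havoid z hzp)
    have hxB : x ∉ B := havoid x p.start_mem_support
    -- A shortest path from `x` to `v` must meet `B` at some $z\ne x$, whence $d(x,v)\ge 1+d(z,v)\ge
    -- 1+d(b,u)\ge d(x,u)+2$.
    obtain ⟨w, hw⟩ := hH.exists_walk_length_eq_dist x v
    rcases isolate_reachable_or_exists (B := B) w with h' | ⟨z, hz, hzw⟩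
    · exact absurd (hreach.symm.trans h') huv
    · classical
      have h1 := SimpleGraph.dist_le (w.dropUntil z hzw)
      have h2 := congrArg SimpleGraph.Walk.length (w.take_spec hzw)
      rw [SimpleGraph.Walk.length_append] at h2
      have h3 := hbv z hz
      have h4 : 0 < (w.takeUntil z hzw).length := by
        rw [Nat.pos_iff_ne_zero]
        intro h0
        exact hxB (SimpleGraph.Walk.eq_of_length_eq_zero h0 ▸ hz)
      exact ⟨x, h, by omega⟩

/-- Outside of `B`, take the vertex of `B` closest to $\{u,v\}$ and step towards the nearer
endpoint; the query goes from there to the other endpoint. If an endpoint lies in `B`, querying the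
pair itself suffices. -/
theorem exists_mem_confirmedNonEdges_of_separated [Fintype V] [DecidableEq V]
    [DecidableRel H.Adj] (hH : H.Connected)
    {u v : V} (hne : u ≠ v) (hadj : ¬ H.Adj u v)
    (huv : ¬ (isolate H B).Reachable u v) :
    ∃ x ∈ closedNhd H B, s(u, v) ∈ confirmedNonEdges H x v ∨ s(u, v) ∈ confirmedNonEdges H x u := by
  have hadj' : ¬ H.Adj v u := fun h => hadj h.symm
  by_cases huB : u ∈ B
  · exact ⟨u, subset_closedNhd B huB, Or.inl (mem_confirmedNonEdges_self hH hne hadj)⟩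
  by_cases hvB : v ∈ B
  · refine ⟨v, subset_closedNhd B hvB, Or.inr ?_⟩
    rw [Sym2.eq_swap]
    exact mem_confirmedNonEdges_self hH hne.symm hadj'
  obtain ⟨p⟩ := hH.preconnected u v
  have hB : B.Nonempty := by
    rcases isolate_reachable_or_exists (B := B) p with h | ⟨z, hz, -⟩
    · exact absurd h huv
    · exact ⟨z, hz⟩
  obtain ⟨b, hb, hmin⟩ := B.exists_min_image (fun z => min (H.dist z u) (H.dist z v)) hB
  rcases le_total (H.dist b u) (H.dist b v) with hle | hle
  · obtain ⟨x, hbx, hx⟩ := exists_adj_dist_add_one_lt hH hb huB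
      (fun z hz => by have := hmin z hz; omega) (fun z hz => by have := hmin z hz; omega) huv
    exact ⟨x, mem_closedNhd_of_adj hb hbx, Or.inl (mem_confirmedNonEdges_of_dist hne hadj hx)⟩
  · obtain ⟨x, hbx, hx⟩ := exists_adj_dist_add_one_lt hH hb hvB
      (fun z hz => by have := hmin z hz; omega) (fun z hz => by have := hmin z hz; omega)
      (fun h => huv h.symm)
    refine ⟨x, mem_closedNhd_of_adj hb hbx, Or.inr ?_⟩
    rw [Sym2.eq_swap]
    exact mem_confirmedNonEdges_of_dist hne.symm hadj' hx

end Separators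

/-! ### Balanced separators from tree decompositions -/

section TreeDecompositions

variable {V : Type u} {H : SimpleGraph V}

theorem TreeDecomposition.exists_node (D : TreeDecomposition H) (v : V) : ∃ t, v ∈ D.bag t := by
  obtain ⟨⟨t, ht⟩⟩ := (D.connected_nodes v).nonempty
  exact ⟨t, ht⟩

theorem TreeDecomposition.card_bag_le (D : TreeDecomposition H) (t : Fin D.size) :
    (D.bag t).card ≤ D.width + 1 := by
  have : (D.bag t).card ≤ Finset.univ.sup fun t => (D.bag t).card :=
    Finset.le_sup (f := fun t => (D.bag t).card) (Finset.mem_univ t)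
  unfold TreeDecomposition.width
  omega

/-- The nodes of a vertex outside of the bag of `t` lie in one component of the tree minus `t`. -/
theorem TreeDecomposition.reachable_of_mem_bag (D : TreeDecomposition H) {t a b : Fin D.size}
    {v : V} (hv : v ∉ D.bag t) (ha : v ∈ D.bag a) (hb : v ∈ D.bag b) :
    (isolate D.tree {t}).Reachable a b := by
  obtain ⟨p⟩ := (D.connected_nodes v).preconnected ⟨a, ha⟩ ⟨b, hb⟩
  have hmap := p.map (⟨Subtype.val, fun {x y} h => ⟨h, ?_, ?_⟩⟩ :
    D.tree.induce {t | v ∈ D.bag t} →g isolate D.tree {t})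
  · exact ⟨hmap⟩
  · rw [Finset.mem_singleton]
    rintro rfl
    exact hv x.2
  · rw [Finset.mem_singleton]
    rintro rfl
    exact hv y.2

/-- The nodes of vertices connected outside of the bag of `t` lie in one component of the tree
minus `t`. -/
theorem TreeDecomposition.reachable_of_reachable (D : TreeDecomposition H) {t : Fin D.size}
    {u v : V} (huv : (isolate H (D.bag t)).Reachable u v) (hu : u ∉ D.bag t) :
    ∀ {a b : Fin D.size}, u ∈ D.bag a → v ∈ D.bag b → (isolate D.tree {t}).Reachable a b := by
  obtain ⟨p⟩ := huv
  induction p with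
  | nil => exact fun ha hb => D.reachable_of_mem_bag hu ha hb
  | cons h p ih =>
    intro a b ha hb
    obtain ⟨x, hx, hx'⟩ := D.exists_bag _ _ h.1
    exact (D.reachable_of_mem_bag hu ha hx).trans (ih h.2.2 hx' hb)

theorem exists_adj_isolate_reachable {W : Type v} {T : SimpleGraph W} (hT : T.Connected)
    {t a : W} (h : a ≠ t) : ∃ t', T.Adj t t' ∧ (isolate T {t}).Reachable t' a := by
  obtain ⟨p, hp⟩ := hT.exists_isPath t a
  cases p with
  | nil => exact absurd rfl h
  | @cons _ t' _ hadj p =>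
    refine ⟨t', hadj, ?_⟩
    rw [SimpleGraph.Walk.cons_isPath_iff] at hp
    rcases isolate_reachable_or_exists (B := {t}) p with h' | ⟨z, hz, hzp⟩
    · exact h'
    · rw [Finset.mem_singleton] at hz
      exact absurd (hz ▸ hzp) hp.2

/-- Neither walk uses the edge $tt'$, so together they would join its endpoints without it; but
every edge of a forest is a bridge. -/
theorem not_reachable_both_of_isAcyclic {W : Type v} {T : SimpleGraph W} (hT : T.IsAcyclic)
    {t t' a : W} (hadj : T.Adj t t') (h : (isolate T {t}).Reachable t' a)
    (h' : (isolate T {t'}).Reachable t a) : False := by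
  have hbridge := SimpleGraph.isAcyclic_iff_forall_adj_isBridge.1 hT hadj
  rw [SimpleGraph.isBridge_iff] at hbridge
  have hle : isolate T {t} ≤ T.deleteEdges {s(t, t')} := by
    intro x y hxy
    rw [SimpleGraph.deleteEdges_adj]
    refine ⟨hxy.1, fun he => ?_⟩
    have h1 := hxy.2.1
    have h2 := hxy.2.2
    rw [Finset.mem_singleton] at h1 h2
    rcases Sym2.eq_iff.1 (Set.mem_singleton_iff.1 he) with ⟨e, -⟩ | ⟨-, e⟩
    · exact h1 e
    · exact h2 e
  have hle' : isolate T {t'} ≤ T.deleteEdges {s(t, t')} := by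
    intro x y hxy
    rw [SimpleGraph.deleteEdges_adj]
    refine ⟨hxy.1, fun he => ?_⟩
    have h1 := hxy.2.1
    have h2 := hxy.2.2
    rw [Finset.mem_singleton] at h1 h2
    rcases Sym2.eq_iff.1 (Set.mem_singleton_iff.1 he) with ⟨-, e⟩ | ⟨e, -⟩
    · exact h2 e
    · exact h1 e
  exact hbridge ((h'.mono hle').trans (h.mono hle).symm)

/-- A tree has fewer edges than vertices, so two vertices choose the same edge and hence point at
each other. -/
theorem exists_adj_mutual_of_isTree {W : Type v} [Fintype W] {T : SimpleGraph W} (hT : T.IsTree)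
    (f : W → W) (hf : ∀ t, T.Adj t (f t)) : ∃ t, f (f t) = t := by
  classical
  have hcard := hT.card_edgeFinset
  obtain ⟨x, -, y, -, hne, hxy⟩ := Finset.exists_ne_map_eq_of_card_lt_of_maps_to
    (s := Finset.univ) (t := T.edgeFinset) (f := fun t => s(t, f t))
    (by rw [Finset.card_univ]; omega)
    (fun t _ => by
      rw [Finset.mem_coe, SimpleGraph.mem_edgeFinset]
      exact hf t)
  rcases Sym2.eq_iff.1 hxy with ⟨e, -⟩ | ⟨e, e'⟩
  · exact absurd e hne
  · exact ⟨x, by rw [e', ← e]⟩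

/-- Some bag of a tree decomposition splits `U` into parts of at most half its size. -/
theorem TreeDecomposition.exists_balanced (D : TreeDecomposition H) (U : Finset V) :
    ∃ t, ∀ u, u ∉ D.bag t → ∀ P ⊆ U, (∀ v ∈ P, (isolate H (D.bag t)).Reachable u v) →
      2 * P.card ≤ U.card := by
  classical
  -- Otherwise every node `t` points to the neighbor `f t` in whose direction a majority `P t` of
  -- `U` lies. Two adjacent nodes point at each other, yet their majorities share a vertex, whose
  -- nodes would then lie on both sides of the edge.
  by_contra hcon
  push Not at hcon
  choose c hct P hPU hP hcard using hcon
  have hnext : ∀ t, ∃ t', D.tree.Adj t t' ∧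
      ∀ v, (isolate H (D.bag t)).Reachable (c t) v → ∀ a, v ∈ D.bag a →
        (isolate D.tree {t}).Reachable t' a := by
    intro t
    obtain ⟨a, ha⟩ := D.exists_node (c t)
    obtain ⟨t', hadj, ht'⟩ := exists_adj_isolate_reachable D.isTree.connected (t := t) (a := a)
      (fun h => hct t (h ▸ ha))
    exact ⟨t', hadj, fun v hv b hb => ht'.trans (D.reachable_of_reachable hv (hct t) ha hb)⟩
  choose f hadj hf using hnext
  obtain ⟨t, ht⟩ := exists_adj_mutual_of_isTree D.isTree f hadj
  obtain ⟨v, hv⟩ : (P t ∩ P (f t)).Nonempty := by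
    rw [← Finset.card_pos]
    have h1 := hcard t
    have h2 := hcard (f t)
    have h3 := Finset.card_union_add_card_inter (P t) (P (f t))
    have h4 := Finset.card_le_card (Finset.union_subset (hPU t) (hPU (f t)))
    omega
  rw [Finset.mem_inter] at hv
  obtain ⟨a, ha⟩ := D.exists_node v
  refine not_reachable_both_of_isAcyclic D.isTree.isAcyclic (hadj t)
    (hf t v (hP t v hv.1) a ha) ?_
  have := hf (f t) v (hP (f t) v hv.2) a ha
  rwa [ht] at this

/-- Only the pairs to be confirmed are restricted to `U`; distances and the decomposition stay those
of `H`, so the same `D` serves at every level. -/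
theorem TreeDecomposition.exists_confirmsOn [Fintype V] [DecidableRel H.Adj] (hH : H.Connected)
    (D : TreeDecomposition H) (k : ℕ) : ∀ U : Finset V, U.card < 2 ^ k →
      ∃ Q : Finset (V × V), ConfirmsOn H U Q ∧
        Q.card ≤ (D.width + 1) * (H.maxDegree + 1) * k * U.card := by
  classical
  induction k with
  | zero =>
    intro U hU
    have : U = ∅ := by simpa using hU
    subst this
    exact ⟨∅, by simp [ConfirmsOn], by simp⟩
  | succ k ih =>
    intro U hU
    obtain ⟨t, ht⟩ := D.exists_balanced U
    set B := D.bag t with hB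
    let comp : V → (isolate H B).ConnectedComponent := (isolate H B).connectedComponentMk
    let part : (isolate H B).ConnectedComponent → Finset V := fun C =>
      (U \ B).filter fun v => comp v = C
    have hsmall : ∀ C, (part C).card < 2 ^ k := by
      intro C
      rcases (part C).eq_empty_or_nonempty with h | ⟨u, hu⟩
      · rw [h]; simp
      · rw [Finset.mem_filter, Finset.mem_sdiff] at hu
        have h1 : 2 * (part C).card ≤ U.card := by
          refine ht u hu.1.2 _ (fun v hv => ?_) fun v hv => ?_
          · exact (Finset.mem_sdiff.1 (Finset.mem_filter.1 hv).1).1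
          · exact SimpleGraph.ConnectedComponent.eq.1 (hu.2.trans (Finset.mem_filter.1 hv).2.symm)
        rw [pow_succ] at hU
        omega
    choose q hq hqcard using fun C => ih (part C) (hsmall C)
    have hsum : ∑ C ∈ U.image comp, (part C).card ≤ U.card := by
      rw [← Finset.card_biUnion]
      · refine Finset.card_le_card (Finset.biUnion_subset.2 fun C _ => ?_)
        exact (Finset.filter_subset _ _).trans Finset.sdiff_subset
      · intro C _ C' _ hne
        rw [Function.onFun, Finset.disjoint_left]
        intro v hv hv'
        exact hne ((Finset.mem_filter.1 hv).2.symm.trans (Finset.mem_filter.1 hv').2)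
    refine ⟨(closedNhd H B ×ˢ U) ∪ (U.image comp).biUnion q, ?_, ?_⟩
    · intro u hu v hv hne hadj
      by_cases huv : (isolate H B).Reachable u v
      · have huB : u ∉ B := fun h => hne (eq_of_isolate_reachable_of_mem huv h)
        have hvB : v ∉ B := fun h => hne (eq_of_isolate_reachable_of_mem huv.symm h).symm
        obtain ⟨p, hp, hmem⟩ := hq (comp u) u
          (Finset.mem_filter.2 ⟨Finset.mem_sdiff.2 ⟨hu, huB⟩, rfl⟩) v
          (Finset.mem_filter.2 ⟨Finset.mem_sdiff.2 ⟨hv, hvB⟩,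
            SimpleGraph.ConnectedComponent.eq.2 huv.symm⟩) hne hadj
        exact ⟨p, Finset.mem_union_right _
          (Finset.mem_biUnion.2 ⟨comp u, Finset.mem_image_of_mem _ hu, hp⟩), hmem⟩
      · obtain ⟨x, hx, h | h⟩ := exists_mem_confirmedNonEdges_of_separated hH hne hadj huv
        · exact ⟨(x, v), Finset.mem_union_left _ (Finset.mk_mem_product hx hv), h⟩
        · exact ⟨(x, u), Finset.mem_union_left _ (Finset.mk_mem_product hx hu), h⟩
    · have h1 : (closedNhd H B).card ≤ (D.width + 1) * (H.maxDegree + 1) :=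
        (card_closedNhd_le B).trans (Nat.mul_le_mul_right _ (D.card_bag_le t))
      have h2 : ((U.image comp).biUnion q).card ≤
          (D.width + 1) * (H.maxDegree + 1) * k * U.card := by
        refine Finset.card_biUnion_le.trans ((Finset.sum_le_sum fun C _ => hqcard C).trans ?_)
        rw [← Finset.mul_sum]
        exact Nat.mul_le_mul_left _ hsum
      refine (Finset.card_union_le _ _).trans ?_
      rw [Finset.card_product]
      calc _ ≤ (D.width + 1) * (H.maxDegree + 1) * U.card +
            (D.width + 1) * (H.maxDegree + 1) * k * U.card :=
            Nat.add_le_add (Nat.mul_le_mul_right _ h1) h2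
        _ = _ := by ring

theorem exists_confirmsOn_of_treewidth [Fintype V] [DecidableRel H.Adj] (hH : H.Connected) :
    ∃ Q : Finset (V × V), ConfirmsOn H Finset.univ Q ∧
      Q.card ≤ (treewidth H + 1) * (H.maxDegree + 1) * (Nat.log 2 (Fintype.card V) + 1) *
        Fintype.card V := by
  obtain ⟨D, hD⟩ : treewidth H ∈ Set.range fun D : TreeDecomposition H => D.width :=
    Nat.sInf_mem (Set.range_nonempty_iff_nonempty.2 (TreeDecomposition.nonempty H))
  rw [← hD]
  exact D.exists_confirmsOn hH _ Finset.univ (Nat.lt_pow_succ_log_self one_lt_two _)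

/-- Allows $\mathrm{tw}+1\le 2\,\mathrm{tw}$ in the final bound. -/
theorem one_le_treewidth_of_adj [Fintype V] {a b : V} (h : H.Adj a b) : 1 ≤ treewidth H := by
  obtain ⟨D, hD⟩ : treewidth H ∈ Set.range fun D : TreeDecomposition H => D.width :=
    Nat.sInf_mem (Set.range_nonempty_iff_nonempty.2 (TreeDecomposition.nonempty H))
  rw [← hD]
  obtain ⟨t, ha, hb⟩ := D.exists_bag a b h
  have h1 : 1 < (D.bag t).card := Finset.one_lt_card.2 ⟨a, ha, b, hb, h.ne⟩
  have h2 := D.card_bag_le t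
  change 1 ≤ D.width
  omega

end TreeDecompositions

/-! ### Centers with small clusters -/

section Averaging

/-- Among `s + 1` independent samples, the first is the strict minimum with probability at most
`1 / (s + 1)`. -/
theorem succ_mul_card_filter_strict_min_le {W : Type v} [Fintype W] (φ : W → ℕ) (s : ℕ) :
    (s + 1) * (Finset.univ.filter fun g : Fin (s + 1) → W =>
      ∀ i, i ≠ 0 → φ (g 0) < φ (g i)).card ≤ Fintype.card W ^ (s + 1) := by
  classical
  -- The events that coordinate `j` is the strict minimum are disjoint, and swapping coordinates
  -- shows that they are equally likely.
  let E : Fin (s + 1) → Finset (Fin (s + 1) → W) := fun j =>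
    Finset.univ.filter fun g => ∀ i, i ≠ j → φ (g j) < φ (g i)
  have hcard : ∀ j, (E j).card = (E 0).card := by
    intro j
    refine Finset.card_equiv ((Equiv.swap 0 j).arrowCongr (Equiv.refl W)) fun g => ?_
    simp only [E, Finset.mem_filter, Finset.mem_univ, true_and, Equiv.arrowCongr_apply,
      Equiv.symm_swap, Function.comp_apply, Equiv.refl_apply, Equiv.swap_apply_left]
    constructor
    · intro h i hi
      refine h _ fun e => hi ?_
      exact (Equiv.swap 0 j).injective (e.trans (Equiv.swap_apply_left 0 j).symm)
    · intro h i hi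
      have := h (Equiv.swap 0 j i) (fun e => hi ?_)
      · simpa using this
      · exact (Equiv.swap 0 j).injective (e.trans (Equiv.swap_apply_right 0 j).symm)
  have hdisj : ((Finset.univ : Finset (Fin (s + 1))) : Set (Fin (s + 1))).PairwiseDisjoint E := by
    intro i _ j _ hne
    rw [Function.onFun, Finset.disjoint_left]
    intro g hg hg'
    have h1 := (Finset.mem_filter.1 hg).2 j hne.symm
    have h2 := (Finset.mem_filter.1 hg').2 i hne
    exact lt_asymm h1 h2
  calc (s + 1) * (E 0).card = ∑ j, (E j).card := by simp [hcard]
    _ = (Finset.univ.biUnion E).card := (Finset.card_biUnion hdisj).symm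
    _ ≤ (Finset.univ : Finset (Fin (s + 1) → W)).card := Finset.card_le_univ _
    _ = Fintype.card W ^ (s + 1) := by simp

theorem card_filter_cons {W : Type v} [Fintype W] (φ : W → ℕ) (s : ℕ) :
    (Finset.univ.filter fun g : Fin (s + 1) → W => ∀ i, i ≠ 0 → φ (g 0) < φ (g i)).card =
      ∑ f : Fin s → W, (Finset.univ.filter fun w => ∀ i, φ w < φ (f i)).card := by
  classical
  rw [← Finset.card_sigma]
  refine (Finset.card_bij' (fun x _ => Fin.cons x.2 x.1) (fun g _ => ⟨Fin.tail g, g 0⟩)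
    ?_ ?_ ?_ ?_).symm
  · rintro ⟨f, w⟩ h
    rw [Finset.mem_sigma, Finset.mem_filter] at h
    rw [Finset.mem_filter]
    refine ⟨Finset.mem_univ _, fun i => Fin.cases (fun h => absurd rfl h) (fun i _ => ?_) i⟩
    simpa using h.2.2 i
  · intro g h
    rw [Finset.mem_filter] at h
    rw [Finset.mem_sigma, Finset.mem_filter]
    exact ⟨Finset.mem_univ _, Finset.mem_univ _, fun i => h.2 i.succ (Fin.succ_ne_zero i)⟩
  · rintro ⟨f, w⟩ -
    simp
  · rintro g -
    simp

/-- A sample of `s` elements such that on average over `w` only few `v ∈ U` are closer to `w` than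
to the sample. -/
theorem exists_sample {V : Type u} {W : Type v} [Fintype W] [Nonempty W] (U : Finset V)
    (φ : V → W → ℕ) (s : ℕ) : ∃ f : Fin s → W,
      (s + 1) * ∑ w, (U.filter fun v => ∀ i, φ v w < φ v (f i)).card ≤
        U.card * Fintype.card W := by
  classical
  -- Averaging over all samples `f`: after exchanging sums, each `v ∈ U` counts the $(s+1)$-tuples
  -- $(w,f)$ whose first entry is the strict minimum of `φ v`.
  by_contra! hcon
  have h1 : ∑ _f : Fin s → W, U.card * Fintype.card W <
      ∑ f : Fin s → W, (s + 1) * ∑ w, (U.filter fun v => ∀ i, φ v w < φ v (f i)).card :=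
    Finset.sum_lt_sum_of_nonempty Finset.univ_nonempty fun f _ => hcon f
  have h2 : ∀ f : Fin s → W, ∑ w, (U.filter fun v => ∀ i, φ v w < φ v (f i)).card =
      ∑ v ∈ U, (Finset.univ.filter fun w => ∀ i, φ v w < φ v (f i)).card := fun f =>
    Finset.sum_card_bipartiteAbove_eq_sum_card_bipartiteBelow fun w v => ∀ i, φ v w < φ v (f i)
  simp only [h2] at h1
  rw [← Finset.mul_sum Finset.univ _ (s + 1), Finset.sum_comm] at h1
  simp only [← card_filter_cons] at h1
  rw [Finset.mul_sum] at h1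
  have h3 := Finset.sum_le_sum fun v (_ : v ∈ U) => succ_mul_card_filter_strict_min_le (φ v) s
  have h4 : ∑ _f : Fin s → W, U.card * Fintype.card W =
      ∑ v ∈ U, Fintype.card W ^ (s + 1) := by
    simp [pow_succ]
    ring
  omega

end Averaging

/-! ### Choice of centers and recursion into their clusters -/

section Clusters

variable {V : Type u} [Fintype V] {H : SimpleGraph V}

open Classical in
/-- The vertices of `U` that are closer to `w` than to `A`. -/
noncomputable def cluster (H : SimpleGraph V) (U A : Finset V) (w : V) : Finset V :=
  U.filter fun v => ∀ a ∈ A, H.dist w v < H.dist a v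

theorem mem_cluster {U A : Finset V} {w v : V} :
    v ∈ cluster H U A w ↔ v ∈ U ∧ ∀ a ∈ A, H.dist w v < H.dist a v := by
  classical
  rw [cluster, Finset.mem_filter]

/-- By Markov's inequality a good sample leaves fewer than half of the vertices of `W` with too
large a cluster. Resampling for those alone takes at most `k` rounds of `s` centers, and adding
centers only shrinks clusters. -/
theorem exists_centers_of_card_lt (U : Finset V) (s k : ℕ) : ∀ W : Finset V, W.card < 2 ^ k →
    ∃ A : Finset V, A.card ≤ s * k ∧ ∀ w ∈ W, (s + 1) * (cluster H U A w).card ≤ 2 * U.card := by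
  classical
  induction k with
  | zero =>
    intro W hW
    have : W = ∅ := by simpa using hW
    subst this
    exact ⟨∅, by simp, by simp⟩
  | succ k ih =>
    intro W hW
    rcases W.eq_empty_or_nonempty with rfl | hne
    · exact ⟨∅, by simp, by simp⟩
    have : Nonempty W := hne.coe_sort
    obtain ⟨f, hf⟩ := exists_sample (W := W) U (fun v w => H.dist w v) s
    set A : Finset V := Finset.univ.image fun i => (f i : V) with hA
    have hcl : ∀ w : W, (U.filter fun v => ∀ i, H.dist w v < H.dist (f i) v) =
        cluster H U A w := by
      intro w
      ext v
      rw [mem_cluster, Finset.mem_filter]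
      simp [hA]
    simp_rw [hcl] at hf
    rw [Finset.sum_coe_sort W fun w => (cluster H U A w).card, Fintype.card_coe] at hf
    set W' := W.filter fun w => 2 * U.card < (s + 1) * (cluster H U A w).card with hW'
    have hW'card : W'.card < 2 ^ k := by
      rcases W'.eq_empty_or_nonempty with h | h
      · rw [h]; simp
      · have h1 : W'.card * (2 * U.card) < ∑ w ∈ W', (s + 1) * (cluster H U A w).card := by
          rw [← smul_eq_mul, ← Finset.sum_const]
          exact Finset.sum_lt_sum_of_nonempty h fun w hw => (Finset.mem_filter.1 hw).2
        have h2 : ∑ w ∈ W', (s + 1) * (cluster H U A w).card ≤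
            ∑ w ∈ W, (s + 1) * (cluster H U A w).card :=
          Finset.sum_le_sum_of_subset (Finset.filter_subset _ _)
        rw [← Finset.mul_sum W] at h2
        have h3 : U.card * (2 * W'.card) < U.card * W.card := by
          calc _ = W'.card * (2 * U.card) := by ring
            _ < _ := h1.trans_le (h2.trans hf)
        have h4 := Nat.lt_of_mul_lt_mul_left h3
        rw [pow_succ] at hW
        omega
    obtain ⟨A', hA', hcl'⟩ := ih W' hW'card
    refine ⟨A ∪ A', ?_, fun w hw => ?_⟩
    · have h1 : A.card ≤ s := Finset.card_image_le.trans (by simp)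
      refine (Finset.card_union_le _ _).trans ?_
      rw [Nat.mul_succ]
      omega
    · by_cases h : w ∈ W'
      · refine (Nat.mul_le_mul_left _ (Finset.card_le_card fun v hv => ?_)).trans (hcl' w h)
        rw [mem_cluster] at hv ⊢
        exact ⟨hv.1, fun a ha => hv.2 a (Finset.mem_union_right _ ha)⟩
      · have h' : (s + 1) * (cluster H U A w).card ≤ 2 * U.card := by
          by_contra hlt
          exact h (Finset.mem_filter.2 ⟨hw, not_le.1 hlt⟩)
        refine (Nat.mul_le_mul_left _ (Finset.card_le_card fun v hv => ?_)).trans h'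
        rw [mem_cluster] at hv ⊢
        exact ⟨hv.1, fun a ha => hv.2 a (Finset.mem_union_left _ ha)⟩

theorem exists_centers (H : SimpleGraph V) (U : Finset V) (s : ℕ) : ∃ A : Finset V,
    A.card ≤ s * (Nat.log 2 (Fintype.card V) + 1) ∧
      ∀ w, (s + 1) * (cluster H U A w).card ≤ 2 * U.card := by
  obtain ⟨A, h1, h2⟩ := exists_centers_of_card_lt (H := H) U s _ Finset.univ
    (Nat.lt_pow_succ_log_self one_lt_two _)
  exact ⟨A, h1, fun w => h2 w (Finset.mem_univ w)⟩

variable [DecidableEq V] [DecidableRel H.Adj]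

theorem exists_mem_closedNhd_closedNhd_dist (hH : H.Connected) {A : Finset V} {a u : V}
    (ha : a ∈ A) (h : 2 ≤ H.dist a u) :
    ∃ b ∈ closedNhd H (closedNhd H A), H.dist b u + 2 ≤ H.dist a u := by
  obtain ⟨p, hp⟩ := hH.exists_walk_length_eq_dist a u
  match p, hp with
  | .nil, hp => simp at h
  | .cons _ .nil, hp => simp at hp; omega
  | .cons h1 (.cons h2 p), hp =>
    refine ⟨_, mem_closedNhd_of_adj (mem_closedNhd_of_adj ha h1) h2, ?_⟩
    have := SimpleGraph.dist_le p
    simp only [SimpleGraph.Walk.length_cons] at hp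
    omega

/-- A non-edge that is not inside of the cluster of a vertex near the centers is confirmed by a
query from a vertex near the centers. -/
theorem exists_mem_confirmedNonEdges_of_centers (hH : H.Connected) {U A : Finset V} {a u v : V}
    (hu : u ∈ U) (hv : v ∈ U) (ha : a ∈ A) (hau : ∀ z ∈ A, H.dist a u ≤ H.dist z u)
    (hav : ∀ z ∈ A, H.dist a u ≤ H.dist z v) (hne : u ≠ v) (hadj : ¬ H.Adj u v) :
    ∃ b ∈ closedNhd H (closedNhd H A), s(u, v) ∈ confirmedNonEdges H b v ∨
      (u ∈ cluster H U A b ∧ v ∈ cluster H U A b) := by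
  by_cases h2 : 2 ≤ H.dist a u
  · obtain ⟨b, hb, hbu⟩ := exists_mem_closedNhd_closedNhd_dist hH ha h2
    refine ⟨b, hb, ?_⟩
    by_cases hlt : H.dist b u + 1 < H.dist b v
    · exact Or.inl (mem_confirmedNonEdges_of_dist hne hadj hlt)
    -- Here $d(b,v)\le d(b,u)+1\le d(a,u)-1$, and $d(a,u)$ bounds from below the distances of both
    -- endpoints to `A`. This is why `b` must be two steps from `a`.
    · refine Or.inr ⟨mem_cluster.2 ⟨hu, fun z hz => ?_⟩, mem_cluster.2 ⟨hv, fun z hz => ?_⟩⟩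
      · have := hau z hz
        omega
      · have := hav z hz
        omega
  · refine ⟨u, ?_, Or.inl (mem_confirmedNonEdges_self hH hne hadj)⟩
    rcases Nat.lt_or_ge (H.dist a u) 1 with h | h
    · rw [Nat.lt_one_iff, hH.dist_eq_zero_iff] at h
      exact subset_closedNhd _ (subset_closedNhd _ (h ▸ ha))
    · have : H.Adj a u := SimpleGraph.dist_eq_one_iff_adj.1 (by omega)
      exact subset_closedNhd _ (mem_closedNhd_of_adj ha this)

/-- Sizes shrink by $2/(s+1)$ per level, so the hypothesis on `U` says that nothing is left after
`j` levels. In the factor $2km+1$, the $2km$ bounds the growth of the total cluster size and the $1$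
absorbs the queries of the level itself. -/
theorem exists_confirmsOn_of_pow (hH : H.Connected) {s : ℕ} (hs : 0 < s) {k m : ℕ}
    (hk : k = Nat.log 2 (Fintype.card V) + 1) (hm : m = (H.maxDegree + 1) ^ 2) (j : ℕ) :
    ∀ U : Finset V, 2 ^ j * U.card < (s + 1) ^ j →
      ∃ Q : Finset (V × V), ConfirmsOn H U Q ∧
        Q.card ≤ s * k * m * (2 * k * m + 1) ^ j * U.card := by
  induction j with
  | zero =>
    intro U hU
    have : U = ∅ := by simpa using hU
    subst this
    exact ⟨∅, by simp [ConfirmsOn], by simp⟩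
  | succ j ih =>
    intro U hU
    rcases U.eq_empty_or_nonempty with rfl | hUne
    · exact ⟨∅, by simp [ConfirmsOn], by simp⟩
    obtain ⟨A₀, hA₀, hcl₀⟩ := exists_centers H U s
    rw [← hk] at hA₀
    -- A nearest center is needed below. If `A₀` is empty, its clusters are all of `U`, so any
    -- single center does as well.
    obtain ⟨A, hA, hAne, hcl⟩ : ∃ A : Finset V, A.card ≤ s * k ∧ A.Nonempty ∧
        ∀ w, (s + 1) * (cluster H U A w).card ≤ 2 * U.card := by
      rcases A₀.eq_empty_or_nonempty with h | h
      · obtain ⟨u, hu⟩ := hUne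
        refine ⟨{u}, ?_, Finset.singleton_nonempty u, fun w => ?_⟩
        · rw [Finset.card_singleton, hk]
          exact Nat.mul_pos hs (Nat.succ_pos _)
        · refine (Nat.mul_le_mul_left _ (Finset.card_le_card fun v hv => ?_)).trans (hcl₀ w)
          rw [mem_cluster] at hv ⊢
          exact ⟨hv.1, by simp [h]⟩
      · exact ⟨A₀, hA₀, h, hcl₀⟩
    set N := closedNhd H (closedNhd H A) with hN
    have hNcard : N.card ≤ s * k * m := by
      refine (card_closedNhd_le _).trans ?_
      refine (Nat.mul_le_mul_right _ (card_closedNhd_le A)).trans ?_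
      rw [hm, sq, ← mul_assoc]
      exact Nat.mul_le_mul_right _ (Nat.mul_le_mul_right _ hA)
    have hsmall : ∀ b, 2 ^ j * (cluster H U A b).card < (s + 1) ^ j := by
      intro b
      have h1 := hcl b
      have h2 : (s + 1) * (2 ^ j * (cluster H U A b).card) < (s + 1) * (s + 1) ^ j := by
        calc _ = 2 ^ j * ((s + 1) * (cluster H U A b).card) := by ring
          _ ≤ 2 ^ j * (2 * U.card) := Nat.mul_le_mul_left _ h1
          _ = 2 ^ (j + 1) * U.card := by ring
          _ < (s + 1) ^ (j + 1) := hU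
          _ = _ := by ring
      exact Nat.lt_of_mul_lt_mul_left h2
    choose q hq hqcard using fun b => ih (cluster H U A b) (hsmall b)
    refine ⟨(N ×ˢ U) ∪ N.biUnion q, ?_, ?_⟩
    · intro u hu v hv hne hadj
      have key : ∃ b ∈ N, (s(u, v) ∈ confirmedNonEdges H b v ∨ s(u, v) ∈ confirmedNonEdges H b u) ∨
          (u ∈ cluster H U A b ∧ v ∈ cluster H U A b) := by
        obtain ⟨a, ha, hmin⟩ :=
          A.exists_min_image (fun z => min (H.dist z u) (H.dist z v)) hAne
        rcases le_total (H.dist a u) (H.dist a v) with hle | hle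
        · obtain ⟨b, hb, h⟩ := exists_mem_confirmedNonEdges_of_centers hH hu hv ha
            (fun z hz => by have := hmin z hz; omega) (fun z hz => by have := hmin z hz; omega)
            hne hadj
          exact ⟨b, hb, by tauto⟩
        · obtain ⟨b, hb, h⟩ := exists_mem_confirmedNonEdges_of_centers hH hv hu ha
            (fun z hz => by have := hmin z hz; omega) (fun z hz => by have := hmin z hz; omega)
            hne.symm (fun h => hadj h.symm)
          rw [Sym2.eq_swap] at h
          exact ⟨b, hb, by tauto⟩
      obtain ⟨b, hb, (h | h) | ⟨hub, hvb⟩⟩ := key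
      · exact ⟨(b, v), Finset.mem_union_left _ (Finset.mk_mem_product hb hv), h⟩
      · exact ⟨(b, u), Finset.mem_union_left _ (Finset.mk_mem_product hb hu), h⟩
      · obtain ⟨p, hp, hmem⟩ := hq b u hub v hvb hne hadj
        exact ⟨p, Finset.mem_union_right _ (Finset.mem_biUnion.2 ⟨b, hb, hp⟩), hmem⟩
    -- The factor `s` in the size of `N` cancels against the $s+1$ in the cluster bound, so `s` is
    -- paid only once and not at every level.
    · have hsum : ∑ b ∈ N, (cluster H U A b).card ≤ 2 * k * m * U.card := by
        refine Nat.le_of_mul_le_mul_left ?_ (Nat.succ_pos s)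
        rw [Finset.mul_sum]
        calc _ ≤ N.card * (2 * U.card) := by
              rw [← smul_eq_mul]
              exact Finset.sum_le_card_nsmul _ _ _ fun b _ => hcl b
          _ ≤ s * k * m * (2 * U.card) := Nat.mul_le_mul_right _ hNcard
          _ = s * (2 * k * m * U.card) := by ring
          _ ≤ _ := Nat.mul_le_mul_right _ (Nat.le_succ s)
      have h2 : (N.biUnion q).card ≤
          s * k * m * (2 * k * m + 1) ^ j * (2 * k * m * U.card) := by
        refine Finset.card_biUnion_le.trans ((Finset.sum_le_sum fun b _ => hqcard b).trans ?_)
        rw [← Finset.mul_sum]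
        exact Nat.mul_le_mul_left _ hsum
      have h3 : s * k * m * U.card ≤ s * k * m * (2 * k * m + 1) ^ j * U.card :=
        Nat.mul_le_mul_right _ (Nat.le_mul_of_pos_right _ (Nat.pow_pos (Nat.succ_pos _)))
      refine (Finset.card_union_le _ _).trans ?_
      rw [Finset.card_product]
      calc _ ≤ s * k * m * (2 * k * m + 1) ^ j * U.card +
            s * k * m * (2 * k * m + 1) ^ j * (2 * k * m * U.card) :=
            Nat.add_le_add ((Nat.mul_le_mul_right _ hNcard).trans h3) h2
        _ = _ := by ring

end Clusters

/-! ### Bounded degree -/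

section Estimates

theorem natLog_add_one_le {n : ℕ} (hn : 2 ≤ n) :
    ((Nat.log 2 n + 1 : ℕ) : ℝ) ≤ 3 * Real.log n := by
  have hn' : (2 : ℝ) ≤ n := by exact_mod_cast hn
  have h2 : (0.6931 : ℝ) < Real.log 2 := lt_trans (by norm_num) Real.log_two_gt_d9
  have hlog : Real.log 2 ≤ Real.log n := Real.log_le_log two_pos hn'
  have h1 : (Nat.log 2 n : ℝ) * Real.log 2 ≤ Real.log n := by
    rw [← Real.log_pow]
    refine Real.log_le_log (by positivity) ?_
    exact_mod_cast Nat.pow_log_le_self 2 (by omega)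
  push_cast
  nlinarith

theorem one_le_log_of_three_le {n : ℕ} (hn : 3 ≤ n) : 1 ≤ Real.log n := by
  have hn' : (3 : ℝ) ≤ n := by exact_mod_cast hn
  rw [Real.le_log_iff_exp_le (by linarith)]
  linarith [Real.exp_one_lt_d9]

theorem natCast_rpow_one_add_mul_sqrt {n : ℕ} (hn : 3 ≤ n) (C : ℝ) {L : ℝ} (hL : 0 ≤ L) :
    (n : ℝ) ^ (1 + C * √(L / Real.log n)) = n * Real.exp (C * √(L * Real.log n)) := by
  have hn0 : (0 : ℝ) < n := by exact_mod_cast (by omega : 0 < n)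
  have hl : 0 < Real.log n := one_pos.trans_le (one_le_log_of_three_le hn)
  have h : Real.log n * √(L / Real.log n) = √(L * Real.log n) := by
    rw [Real.sqrt_div hL, Real.sqrt_mul hL, mul_div_assoc']
    rw [div_eq_iff (Real.sqrt_pos.2 hl).ne', mul_assoc, Real.mul_self_sqrt hl.le, mul_comm]
  rw [Real.rpow_add hn0, Real.rpow_one, Real.rpow_def_of_pos hn0, ← h]
  congr 2
  ring

/-- With $l=\log n$, constants are absorbed into powers of $lD\ge 2$, so that every factor becomes a
power of $e^L=lD$. -/
theorem two_mul_mul_sq_add_one_le {D k l : ℝ} (hl : 1 ≤ l) (hD : 2 ≤ D) (hk : k ≤ 3 * l) :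
    2 * k * (D + 1) ^ 2 + 1 ≤ (l * D) ^ 7 := by
  have hE : 2 ≤ l * D := by nlinarith
  have hlD : 1 ≤ l * D ^ 2 := by nlinarith
  have hm : (D + 1) ^ 2 ≤ 4 * D ^ 2 := by nlinarith
  have h1 : k * (D + 1) ^ 2 ≤ 3 * l * (4 * D ^ 2) := by gcongr
  have h3 : l * D ^ 2 ≤ (l * D) ^ 2 := by
    rw [mul_pow]
    gcongr
    nlinarith
  have h4 : (32 : ℝ) ≤ (l * D) ^ 5 := by
    calc (32 : ℝ) = 2 ^ 5 := by norm_num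
      _ ≤ (l * D) ^ 5 := by gcongr
  calc _ ≤ 32 * (l * D) ^ 2 := by linarith
    _ ≤ (l * D) ^ 5 * (l * D) ^ 2 := by gcongr
    _ = (l * D) ^ 7 := by ring

theorem one_add_two_mul_le {D l : ℝ} (hl : 1 ≤ l) (hD : 2 ≤ D) : 1 + 2 * l ≤ (l * D) ^ 3 := by
  have hE : 2 ≤ l * D := by nlinarith
  calc _ ≤ 2 ^ 2 * l := by linarith
    _ ≤ (l * D) ^ 2 * (l * D) := by
      gcongr
      nlinarith
    _ = (l * D) ^ 3 := by ring

theorem add_mul_le_mul_exp {n D k l s L X : ℝ} {j : ℕ} (hn : 0 ≤ n) (hl : 1 ≤ l) (hD : 2 ≤ D)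
    (hk0 : 0 ≤ k) (hk : k ≤ 3 * l) (hL : Real.exp L = l * D) (hLX : L ≤ 2 * X) (hX : 0 ≤ X)
    (hLj : L * j ≤ X + L) (hs : s ≤ 4 * Real.exp X) :
    n * D + (s * k * (D + 1) ^ 2 * (2 * k * (D + 1) ^ 2 + 1) ^ j * n) * (1 + 2 * l) ≤
      n * Real.exp (48 * X) := by
  have hkm := two_mul_mul_sq_add_one_le hl hD hk
  have hlast := one_add_two_mul_le hl hD
  have hE2 : 2 ≤ l * D := by nlinarith
  have hED : D ≤ l * D := by nlinarith
  rw [← hL] at hkm hlast hE2 hED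
  set E := Real.exp L with hE
  have hpow : ∀ i : ℕ, E ^ i = Real.exp (i * L) := fun i => (Real.exp_nat_mul L i).symm
  have hs' : s ≤ E ^ 2 * Real.exp X := by
    refine hs.trans ?_
    gcongr
    nlinarith
  have hkm' : k * (D + 1) ^ 2 ≤ E ^ 7 := by
    have : 0 ≤ k * (D + 1) ^ 2 := by positivity
    linarith
  have hmain : (s * k * (D + 1) ^ 2 * (2 * k * (D + 1) ^ 2 + 1) ^ j * n) * (1 + 2 * l) ≤
      n * Real.exp (46 * X) := by
    calc _ = s * (k * (D + 1) ^ 2) * (2 * k * (D + 1) ^ 2 + 1) ^ j * n * (1 + 2 * l) := by ring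
      _ ≤ (E ^ 2 * Real.exp X) * E ^ 7 * (E ^ 7) ^ j * n * E ^ 3 := by gcongr
      _ = n * (Real.exp X * E ^ (12 + 7 * j)) := by ring
      _ = n * Real.exp (X + (12 + 7 * j) * L) := by
          rw [hpow, Real.exp_add]
          push_cast
          ring
      -- $12L\le 24X$ and $7jL\le 7X+7L\le 21X$, so the exponent is at most $(1+24+21)X$.
      _ ≤ n * Real.exp (46 * X) := by
          gcongr
          linarith
  have hfirst : n * D ≤ n * Real.exp (46 * X) := by
    refine mul_le_mul_of_nonneg_left (hED.trans (Real.exp_le_exp.2 ?_)) hn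
    linarith
  have h2X : (2 : ℝ) ≤ Real.exp (2 * X) := hE2.trans (Real.exp_le_exp.2 hLX)
  calc _ ≤ n * Real.exp (46 * X) * 2 := by linarith
    _ ≤ n * Real.exp (46 * X) * Real.exp (2 * X) := by gcongr
    _ = n * Real.exp (48 * X) := by
      rw [mul_assoc, ← Real.exp_add]
      congr 2
      ring

/-- With $X=\sqrt{L\log n}$, the depth $j=\lceil \log n/X\rceil$ balances the two costs: $n^{1/j}\le
e^X$ and $Lj\le X+L$. The bound $\Delta\le n$ gives $L\le 2\log n$ and hence $L\le 2X$. -/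
theorem exists_parameters {n Δ : ℕ} (hn : 3 ≤ n) (hΔ : 2 ≤ Δ) (hΔn : Δ ≤ n) :
    ∃ s j : ℕ, 0 < s ∧ 2 ^ j * n < (s + 1) ^ j ∧
      (n * Δ : ℝ) + ((s * (Nat.log 2 n + 1) * (Δ + 1) ^ 2 *
        (2 * (Nat.log 2 n + 1) * (Δ + 1) ^ 2 + 1) ^ j * n : ℕ) : ℝ) * (1 + 2 * Real.log n) ≤
      n * Real.exp (48 * √((Real.log (Real.log n) + Real.log Δ) * Real.log n)) := by
  have hn0 : (0 : ℝ) < n := by exact_mod_cast (by omega : 0 < n)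
  have hΔ2 : (2 : ℝ) ≤ Δ := by exact_mod_cast hΔ
  have hΔ0 : (0 : ℝ) < Δ := by linarith
  have hl1 := one_le_log_of_three_le hn
  have hk := natLog_add_one_le (by omega : 2 ≤ n)
  set k := Nat.log 2 n + 1 with hkdef
  have hlogΔ : Real.log Δ ≤ Real.log n := Real.log_le_log hΔ0 (by exact_mod_cast hΔn)
  set l := Real.log n with hl
  have hl0 : 0 < l := by linarith
  set L := Real.log l + Real.log Δ with hL
  have hll0 : 0 ≤ Real.log l := Real.log_nonneg hl1
  have hLlow : Real.log 2 ≤ L := by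
    have := Real.log_le_log two_pos hΔ2
    linarith
  have hL0 : 0 < L := (Real.log_pos one_lt_two).trans_le hLlow
  have hLup : L ≤ 2 * l := by
    have := Real.log_le_sub_one_of_pos hl0
    linarith
  set X := √(L * l) with hX
  have hX0 : 0 < X := Real.sqrt_pos.2 (mul_pos hL0 hl0)
  have hXX : X * X = L * l := Real.mul_self_sqrt (mul_pos hL0 hl0).le
  have hLX : L ≤ 2 * X := by
    by_contra! h
    nlinarith
  have hexpL : Real.exp L = l * Δ := by
    rw [hL, Real.exp_add, Real.exp_log hl0, Real.exp_log hΔ0]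
  set j := ⌈l / X⌉₊ with hj
  have hlX : 0 < l / X := div_pos hl0 hX0
  have hj0 : 0 < j := Nat.ceil_pos.2 hlX
  have hj0' : (0 : ℝ) < j := by exact_mod_cast hj0
  have hj1 : l / X ≤ j := Nat.le_ceil _
  have hj2 : (j : ℝ) ≤ l / X + 1 := (Nat.ceil_lt_add_one hlX.le).le
  have hljX : l / j ≤ X := by
    rw [div_le_iff₀ hj0']
    rw [div_le_iff₀ hX0] at hj1
    linarith
  have hLj : L * j ≤ X + L := by
    have h1 : L * (l / X) = X := by
      rw [← mul_div_assoc, div_eq_iff hX0.ne', hXX]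
    nlinarith
  set y := (n : ℝ) ^ (1 / (j : ℝ)) with hy
  have hy1 : 1 ≤ y := Real.one_le_rpow (by exact_mod_cast (by omega : 1 ≤ n)) (by positivity)
  have hyexp : y ≤ Real.exp X := by
    rw [hy, Real.rpow_def_of_pos hn0]
    refine Real.exp_le_exp.2 ?_
    rw [← hl, mul_one_div]
    exact hljX
  have hyj : y ^ j = n := by
    rw [hy, ← Real.rpow_natCast, ← Real.rpow_mul hn0.le, one_div, inv_mul_cancel₀ hj0'.ne',
      Real.rpow_one]
  set r := ⌊y⌋₊ + 1 with hr
  have hry : y < r := by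
    rw [hr]
    exact_mod_cast Nat.lt_floor_add_one y
  have hr2 : (r : ℝ) ≤ 2 * y := by
    have := Nat.floor_le (zero_le_one.trans hy1)
    rw [hr]
    push_cast
    linarith
  -- Then $s+1=2r$ with $r>n^{1/j}$, so the factor $2^j$ cancels.
  refine ⟨2 * r - 1, j, by omega, ?_, ?_⟩
  · have h1 : (n : ℝ) < (r : ℝ) ^ j := by
      rw [← hyj]
      exact pow_lt_pow_left₀ hry (by linarith) hj0.ne'
    have h2 : n < r ^ j := by exact_mod_cast h1
    rw [show 2 * r - 1 + 1 = 2 * r by omega, mul_pow]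
    exact Nat.mul_lt_mul_of_pos_left h2 (by positivity)
  · have hs : ((2 * r - 1 : ℕ) : ℝ) ≤ 4 * Real.exp X := by
      have h1 : ((2 * r - 1 : ℕ) : ℝ) ≤ ((2 * r : ℕ) : ℝ) := by exact_mod_cast Nat.sub_le _ _
      push_cast at h1
      linarith
    have := add_mul_le_mul_exp hn0.le hl1 hΔ2 (Nat.cast_nonneg k) hk hexpL hLX hX0.le hLj
      hs
    exact_mod_cast this

end Estimates

/-! ### Explicit query bounds in terms of degree and treewidth -/

section Bounds

variable {V : Type u} [Fintype V] (H : SimpleGraph V) [DecidableRel H.Adj]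

/-- Connectedness forces at least $n-1$ edges, so the degree sum is at least $2n-2>n$. -/
theorem two_le_maxDegree (hH : H.Connected) (hn : 3 ≤ Fintype.card V) : 2 ≤ H.maxDegree := by
  classical
  have h1 := H.sum_degrees_eq_twice_card_edges
  have h2 : ∑ v, H.degree v ≤ Fintype.card V * H.maxDegree := by
    rw [← smul_eq_mul, ← Finset.card_univ]
    exact Finset.sum_le_card_nsmul _ _ _ fun v _ => H.degree_le_maxDegree v
  have h3 := hH.card_vert_le_card_edgeSet_add_one
  rw [Nat.card_eq_fintype_card, Nat.card_eq_fintype_card, ← SimpleGraph.edgeFinset_card] at h3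
  by_contra! h
  have h4 : Fintype.card V * H.maxDegree ≤ Fintype.card V * 1 :=
    Nat.mul_le_mul_left _ (by omega)
  omega

theorem greedyVerifiesWithin_of_maxDegree (hH : H.Connected) (hn : 3 ≤ Fintype.card V) :
    GreedyVerifiesWithin H ((Fintype.card V : ℝ) ^
      (1 + 48 * √((Real.log (Real.log (Fintype.card V)) + Real.log H.maxDegree) /
        Real.log (Fintype.card V)))) := by
  classical
  have hne : Nonempty V := hH.nonempty
  have hΔ := two_le_maxDegree H hH hn
  obtain ⟨s, j, hs, hsj, hbound⟩ :=
    exists_parameters hn hΔ (H.maxDegree_lt_card_verts).le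
  obtain ⟨Q, hQ, hcard⟩ := exists_confirmsOn_of_pow hH hs rfl rfl j Finset.univ
    (by rwa [Finset.card_univ])
  rw [Finset.card_univ] at hcard
  have hl := one_le_log_of_three_le hn
  rw [natCast_rpow_one_add_mul_sqrt hn _
    (add_nonneg (Real.log_nonneg hl) (Real.log_natCast_nonneg _))]
  refine (greedyVerifiesWithin_of_confirmsOn hH hQ).mono (le_trans ?_ hbound)
  gcongr

theorem greedyVerifiesWithin_of_treewidth (hH : H.Connected) :
    GreedyVerifiesWithin H (100 * ((H.maxDegree : ℝ) *
      ((H.maxDegree : ℝ) + (treewidth H : ℝ) * Real.log (Fintype.card V)) *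
      (Fintype.card V : ℝ) * Real.log (Fintype.card V) ^ 2)) := by
  classical
  have hne : Nonempty V := hH.nonempty
  rcases (Nat.succ_le_of_lt (Fintype.card_pos (α := V))).eq_or_lt with h1 | hn
  -- The claimed bound is 0 here, as $\log 1=0$; there is nothing to query.
  · have hsub : Subsingleton V := Fintype.card_le_one_iff_subsingleton.1 h1.symm.le
    have hQ : ConfirmsOn H Finset.univ ∅ := fun u _ v _ huv => absurd (Subsingleton.elim u v) huv
    refine (greedyVerifiesWithin_of_confirmsOn hH hQ).mono ?_
    simp
  · obtain ⟨Q, hQ, hcard⟩ := exists_confirmsOn_of_treewidth hH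
    refine (greedyVerifiesWithin_of_confirmsOn hH hQ).mono ?_
    have : Nontrivial V := Fintype.one_lt_card_iff_nontrivial.1 hn
    obtain ⟨a, b, hab⟩ : ∃ a b, H.Adj a b :=
      ⟨hne.some, hH.preconnected.exists_adj_of_nontrivial hne.some⟩
    have htw : (1 : ℝ) ≤ treewidth H := by exact_mod_cast one_le_treewidth_of_adj hab
    have hΔ : (1 : ℝ) ≤ H.maxDegree := by
      exact_mod_cast ((H.degree_pos_iff_exists_adj a).2 ⟨b, hab⟩).trans_le
        (H.degree_le_maxDegree a)
    have hk := natLog_add_one_le hn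
    have hl : (0.6931 : ℝ) ≤ Real.log (Fintype.card V) :=
      (lt_trans (by norm_num) Real.log_two_gt_d9).le.trans
        (Real.log_le_log two_pos (by exact_mod_cast hn))
    have hcard' : (Q.card : ℝ) ≤ (treewidth H + 1) * (H.maxDegree + 1) *
        ((Nat.log 2 (Fintype.card V) + 1 : ℕ) : ℝ) * Fintype.card V := by
      exact_mod_cast hcard
    have hn0 : (0 : ℝ) ≤ Fintype.card V := Nat.cast_nonneg _
    generalize (Fintype.card V : ℝ) = n at *
    generalize (treewidth H : ℝ) = t at *
    generalize (H.maxDegree : ℝ) = D at *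
    generalize Real.log n = l at *
    have hQb : (Q.card : ℝ) ≤ (2 * t) * (2 * D) * (3 * l) * n := by
      refine hcard'.trans ?_
      gcongr <;> linarith
    have hQl : (Q.card : ℝ) * (1 + 2 * l) ≤ (2 * t) * (2 * D) * (3 * l) * n * (4 * l) := by
      gcongr
      linarith
    have hl2 : 1 ≤ 3 * l ^ 2 := by nlinarith
    have hfirst : n * D ≤ 3 * (D * D * n * l ^ 2) := by
      have h1 : n * D * 1 ≤ n * D * (D * (3 * l ^ 2)) := by
        gcongr
        nlinarith
      linarith
    -- The cover costs $48\,tDnl^2$, a factor $l$ less than claimed; since $2l\ge 1$ this gives the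
    -- constant 96, and the edge queries add 3.
    have hsecond : t * D * n * l ^ 2 ≤ 2 * (D * (t * l) * n * l ^ 2) := by
      have h1 : t * D * n * l ^ 2 * 1 ≤ t * D * n * l ^ 2 * (2 * l) := by
        gcongr
        linarith
      linarith
    have h3 : 0 ≤ D * D * n * l ^ 2 := by positivity
    have h4 : 0 ≤ D * (t * l) * n * l ^ 2 := by positivity
    nlinarith

end Bounds

/-! ### Uniform asymptotic forms -/

section Asymptotics

theorem tendsto_log_log_div_log : Filter.Tendsto
    (fun n : ℕ => Real.log (Real.log n) / Real.log n) Filter.atTop (nhds 0) :=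
  Real.isLittleO_log_id_atTop.tendsto_div_nhds_zero.comp
    (Real.tendsto_log_atTop.comp tendsto_natCast_atTop_atTop)

theorem exists_exponent {Δ : ℕ → ℕ} {ε : ℕ → ℝ} (hε : Filter.Tendsto ε Filter.atTop (nhds 0))
    (hΔ : ∀ᶠ n : ℕ in Filter.atTop, (Δ n : ℝ) ≤ (n : ℝ) ^ ε n) :
    ∃ η : ℕ → ℝ, Filter.Tendsto η Filter.atTop (nhds 0) ∧
      ∀ᶠ n : ℕ in Filter.atTop,
        ∀ (V : Type u) [Fintype V] (H : SimpleGraph V) [DecidableRel H.Adj],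
          H.Connected → Fintype.card V = n → H.maxDegree ≤ Δ n →
          GreedyVerifiesWithin H ((n : ℝ) ^ (1 + η n)) := by
  -- $\log\Delta/\log n\le|\varepsilon(n)|$; this exponent depends on `n` alone, which gives
  -- uniformity.
  refine ⟨fun n => 48 * √(Real.log (Real.log n) / Real.log n + |ε n|), ?_, ?_⟩
  · have h := ((tendsto_log_log_div_log.add hε.abs).sqrt).const_mul 48
    simpa using h
  · filter_upwards [hΔ, Filter.eventually_ge_atTop 3] with n hn hn3 V _ H _ hH hV hdeg
    subst hV
    refine (greedyVerifiesWithin_of_maxDegree H hH hn3).mono ?_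
    have hl := one_le_log_of_three_le hn3
    have hn0 : (0 : ℝ) < Fintype.card V := by exact_mod_cast (by omega : 0 < Fintype.card V)
    have hD : (0 : ℝ) < H.maxDegree := by
      exact_mod_cast two_pos.trans_le (two_le_maxDegree H hH hn3)
    have hlogD : Real.log H.maxDegree ≤ |ε (Fintype.card V)| * Real.log (Fintype.card V) := by
      have h1 : (H.maxDegree : ℝ) ≤ (Fintype.card V : ℝ) ^ ε (Fintype.card V) :=
        le_trans (by exact_mod_cast hdeg) hn
      have h2 := Real.log_le_log hD h1
      rw [Real.log_rpow hn0] at h2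
      refine h2.trans ?_
      gcongr
      exact le_abs_self _
    refine Real.rpow_le_rpow_of_exponent_le (by exact_mod_cast (by omega : 1 ≤ Fintype.card V)) ?_
    gcongr
    rw [add_div]
    gcongr
    rw [div_le_iff₀ (by linarith)]
    exact hlogD

theorem exists_polylog_bound {Δ τ : ℕ → ℕ} {k : ℕ}
    (hΔ : (fun n : ℕ => (Δ n : ℝ)) =O[Filter.atTop] fun n : ℕ => Real.log n ^ k)
    (hτ : (fun n : ℕ => (τ n : ℝ)) =O[Filter.atTop] fun n : ℕ => Real.log n ^ k) :
    ∃ (C : ℝ) (m : ℕ), ∀ᶠ n : ℕ in Filter.atTop,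
      ∀ (V : Type u) [Fintype V] (H : SimpleGraph V) [DecidableRel H.Adj],
        H.Connected → Fintype.card V = n → H.maxDegree ≤ Δ n → treewidth H ≤ τ n →
        GreedyVerifiesWithin H (C * ((n : ℝ) * Real.log n ^ m)) := by
  obtain ⟨c, hc0, hc⟩ := hΔ.exists_pos
  obtain ⟨d, hd0, hd⟩ := hτ.exists_pos
  -- The product of the two polylogarithmic factors gives $2k$, the factor $l$ beside the treewidth
  -- 1, and $l^2$ the remaining 2.
  refine ⟨100 * (c * (c + d)), 2 * k + 3, ?_⟩
  filter_upwards [hc.bound, hd.bound, Filter.eventually_ge_atTop 3]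
    with n hcn hdn hn3 V _ H _ hH hV hdeg htw
  subst hV
  refine (greedyVerifiesWithin_of_treewidth H hH).mono ?_
  have hl := one_le_log_of_three_le hn3
  rw [Real.norm_natCast, Real.norm_of_nonneg (by positivity)] at hcn hdn
  have h1 : (H.maxDegree : ℝ) ≤ c * Real.log (Fintype.card V) ^ k :=
    le_trans (by exact_mod_cast hdeg) hcn
  have h2 : (treewidth H : ℝ) ≤ d * Real.log (Fintype.card V) ^ k :=
    le_trans (by exact_mod_cast htw) hdn
  have hn0 : (0 : ℝ) ≤ Fintype.card V := Nat.cast_nonneg _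
  generalize (Fintype.card V : ℝ) = n at *
  generalize Real.log n = l at *
  calc _ ≤ 100 * ((c * l ^ k) * (c * l ^ k * l + (d * l ^ k) * l) * n * l ^ 2) := by
        have h3 : c * l ^ k ≤ c * l ^ k * l := le_mul_of_one_le_right (by positivity) hl
        have h4 : (H.maxDegree : ℝ) ≤ c * l ^ k * l := h1.trans h3
        gcongr
    _ = _ := by ring

end Asymptotics

theorem corollary2 :
    (∃ C : ℝ, 0 < C ∧
      ∀ (V : Type u) [Fintype V] (H : SimpleGraph V) [DecidableRel H.Adj],
        H.Connected → 3 ≤ Fintype.card V →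
        GreedyVerifiesWithin H
          ((Fintype.card V : ℝ) ^
            (1 + C * √((Real.log (Real.log (Fintype.card V)) + Real.log H.maxDegree) /
              Real.log (Fintype.card V))))) ∧
    (∀ Δ : ℕ → ℕ,
      (∃ ε : ℕ → ℝ, Filter.Tendsto ε Filter.atTop (nhds 0) ∧
        ∀ᶠ n : ℕ in Filter.atTop, (Δ n : ℝ) ≤ (n : ℝ) ^ ε n) →
      ∃ η : ℕ → ℝ, Filter.Tendsto η Filter.atTop (nhds 0) ∧
        ∀ᶠ n : ℕ in Filter.atTop,
          ∀ (V : Type u) [Fintype V] (H : SimpleGraph V) [DecidableRel H.Adj],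
            H.Connected → Fintype.card V = n → H.maxDegree ≤ Δ n →
            GreedyVerifiesWithin H ((n : ℝ) ^ (1 + η n))) ∧
    (∃ C : ℝ, 0 < C ∧
      ∀ (V : Type u) [Fintype V] (H : SimpleGraph V) [DecidableRel H.Adj],
        H.Connected →
        GreedyVerifiesWithin H
          (C * ((H.maxDegree : ℝ) *
            ((H.maxDegree : ℝ) + (treewidth H : ℝ) * Real.log (Fintype.card V)) *
            (Fintype.card V : ℝ) * Real.log (Fintype.card V) ^ 2))) ∧
    (∀ (Δ τ : ℕ → ℕ) (k : ℕ),
      ((fun n : ℕ => (Δ n : ℝ)) =O[Filter.atTop] fun n : ℕ => Real.log n ^ k) →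
      ((fun n : ℕ => (τ n : ℝ)) =O[Filter.atTop] fun n : ℕ => Real.log n ^ k) →
      ∃ (C : ℝ) (m : ℕ), ∀ᶠ n : ℕ in Filter.atTop,
        ∀ (V : Type u) [Fintype V] (H : SimpleGraph V) [DecidableRel H.Adj],
          H.Connected → Fintype.card V = n → H.maxDegree ≤ Δ n → treewidth H ≤ τ n →
          GreedyVerifiesWithin H (C * ((n : ℝ) * Real.log n ^ m))) := by
  refine ⟨⟨48, by norm_num, fun V _ H _ hH hn => greedyVerifiesWithin_of_maxDegree H hH hn⟩,
    fun Δ ⟨ε, hε, hΔ⟩ => exists_exponent hε hΔ,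
    ⟨100, by norm_num, fun V _ H _ hH => greedyVerifiesWithin_of_treewidth H hH⟩,
    fun Δ τ k hΔ hτ => exists_polylog_bound hΔ hτ⟩
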